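/- Let $\mathbb{T}=\mathbb{R}/\mathbb{Z}$ with Lebesgue measure, let $\alpha\in\mathbb{R}$ be irrational and let $T\colon\mathbb{T}\to\mathbb{T}$, $Tx=x+\alpha$. A measurable map $\varphi\colon\mathbb{T}\to\mathbb{S}^1=\{z\in\mathbb{C}\colon|z|=1\}$ is called a $T$-coboundary if there is a measurable $\xi\colon\mathbb{T}\to\mathbb{S}^1$ with $\varphi(x)=\xi(x)\,\xi(Tx)^{-1}$ for almost every $x$. For $f\colon\mathbb{T}\to\mathbb{R}$ write $\widehat f(n)=\int_{\mathbb{T}}f(x)e^{-2\pi i nx}\,dx$ and $f^{(m)}(x)=\sum_{j=0}^{m-1}f(x+j\alpha)$ for integers $m\ge 1$. Let $f\colon\mathbb{T}\to\mathbb{R}$ be of class $C^{1+\delta}$ for some $\delta>0$, with $\int_{\mathbb{T}}f(x)\,dx=0$. Let $r>s\ge 1$ be relatively prime integers. Let $(p_n/q_n)_{n\in\mathbb{N}}$ be a subsequence of the sequence of convergents of the continued fraction expansion of $\alpha$, and suppose that there is a constant $c_0>0$ such that for every $n$ $$\frac{|\widehat f(q_n)|}{\sum_{k\ge1}|\widehat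 f(kq_n)|}>c_0,\tag{28a}$$ $$\frac{|\widehat f(q_n)|}{|\widehat f(q_n)|+\sum_{k\ge1}\left|\widehat f\left(k\tfrac rs q_n\right)\right|}>c_0\quad\text{whenever } s\mid q_n,\tag{28b}$$ and that $$\frac{\left|\alpha-\frac{p_n}{q_n}\right|q_n}{|\widehat f(q_n)|}\longrightarrow0\quad\text{as }n\to\infty.\tag{29a}$$ Then for all $\lambda\in\mathbb{S}^1$, $h\in\mathbb{R}$ and $A,B\in\mathbb{R}$ with $A^2+B^2\ne0$, the cocycle $$x\mapsto\lambda\,e^{2\pi i\left(Af^{(r)}(rx)+Bf^{(s)}(sx+h)\right)}$$ is not a $T$-coboundary. -/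

import Mathlib

open Filter Topology MeasureTheory
open scoped NNReal

noncomputable section

/-- The class `C^β` (`β ≥ 0` real) of functions on the circle `ℝ/ℤ`: writing `β = k + γ` with
`k = ⌊β⌋` and `0 ≤ γ < 1`, the `1`-periodic lift of `f` to `ℝ` is `k` times continuously
differentiable and its `k`-th derivative is Hölder continuous of exponent `γ` (for `γ = 0` this
only says that the `k`-th derivative has bounded oscillation, which holds by periodicity). -/
def IsHolderClass (β : ℝ) (f : UnitAddCircle → ℝ) : Prop :=
  ContDiff ℝ (⌊β⌋₊ : ℕ) (fun x : ℝ => f (x : UnitAddCircle)) ∧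
    ∃ C : ℝ≥0, HolderWith C (Int.fract β).toNNReal
      (iteratedDeriv ⌊β⌋₊ (fun x : ℝ => f (x : UnitAddCircle)))

/-- The `n`-th Fourier coefficient `∫ f(x) e^{-2πinx} dx` of a real function on the circle. -/
def fourierHat (f : UnitAddCircle → ℝ) (n : ℤ) : ℂ :=
  fourierCoeff (fun x : UnitAddCircle => (f x : ℂ)) n

/-- The circleRotation `x ↦ x + α` of `ℝ/ℤ`. -/
def circleRotation (α : ℝ) (x : UnitAddCircle) : UnitAddCircle :=
  x + (α : UnitAddCircle)

/-- `(p n / q n)` is a subsequence of the sequence of convergents of the regular continued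
fraction expansion of `α`, with `p n` and `q n` the numerators and denominators given by the
standard recurrences. -/
def IsSubseqOfConvergents (α : ℝ) (p : ℕ → ℤ) (q : ℕ → ℕ) : Prop :=
  ∃ k : ℕ → ℕ, StrictMono k ∧ ∀ n,
    (p n : ℝ) = (GenContFract.of α).nums (k n) ∧ (q n : ℝ) = (GenContFract.of α).dens (k n)

/-- `φ : X → G` is a `T`-coboundary: `φ(x) = ξ(x) ξ(Tx)⁻¹` for `μ`-almost every `x`, with a
(Borel) measurable transfer function `ξ : X → G`. -/
def IsCoboundary {X G : Type*} [MeasurableSpace X] [CommGroup G] [TopologicalSpace G]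
    (μ : Measure X) (T : X → X) (φ : X → G) : Prop :=
  ∃ ξ : X → G, Measurable[_, borel G] ξ ∧ ∀ᵐ x ∂μ, φ x = ξ x * (ξ (T x))⁻¹

/-- The cocycle `x ↦ z e^{2πi (A f^{(r)}(rx) + B f^{(s)}(sx + h))}`, where
`f^{(m)}(x) = ∑_{j < m} f(x + jα)`. -/
def twistedCocycle (α : ℝ) (f : UnitAddCircle → ℝ) (r s : ℕ) (z : Circle) (h A B : ℝ)
    (x : UnitAddCircle) : Circle :=
  z * Circle.exp (2 * Real.pi *
    (A * birkhoffSum (circleRotation α) f r (r • x) +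
      B * birkhoffSum (circleRotation α) f s (s • x + (h : UnitAddCircle))))

end

/-!
Suppose that the cocycle `φ` were a coboundary with transfer function `ξ`. Its iterated product
along `T` of length `m` equals `ξ / ξ ∘ T^m` almost everywhere, so it tends to `1` in `L¹` along any
times `m` with `mα → 0` modulo `1` (`IsCoboundary.tendsto_integral_norm_prod_sub_one`). This product
is a constant times `exp (2πi E_m)` with `E_m(x) = A f^{(rm)}(rx) + B f^{(sm)}(sx + h)`
(`prod_twistedCocycle_iterate`).

Let `a = |f̂(q)|` for `q = q_n`, and take `m = lq` with `l ≈ c / (qa)`, where `c > 0` is a small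
constant. Such `l` exist because `q f̂(q) → 0` for `f` of class `C¹`
(`tendsto_mul_norm_fourierHat_zero`), and `mα → 0` modulo `1` because `q |α - p/q| / a → 0`.
Replacing the rotation by `α` with the rotation by `p / q` inside each block of length `q` changes
`f^{(lq)}` only by `O(lq · q |α - p/q|) = O(c q |α - p/q| / a) → 0`
(`abs_birkhoffSum_sub_blockSum_le`), and leaves a function `G` that only has frequencies divisible
by `q`. The bound of `∑ |f̂(kq)|` by a multiple of `a` gives `|G| = O(c)` uniformly in `n`
(`abs_twistedBlockSum_le`). On the other hand, `G` has a Fourier coefficient of size at least a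
fixed multiple of `c` at a nonzero frequency (`exists_le_norm_fourierHat_twistedBlockSum`). This
frequency is `sq` if `B ≠ 0`, since the other summand only has frequencies divisible by `rq` and
`s < r`; it is `rq` if `B = 0`.

Since `exp (2πiG) = 1 + 2πiG + O(c²)`, for small `c` the coefficient of `exp (2πiG)` at that
frequency stays away from `0`, which contradicts the convergence of a constant multiple of
`exp (2πi E_m)` to `1` (`two_pi_mul_norm_fourierHat_le`).
-/

/-! ### Convergents -/

open GenContFract in
lemma GenContFract.exists_int_eq_contsAux (v : ℝ) (n : ℕ) :
    ∃ a b : ℤ, ((GenContFract.of v).contsAux n).a = a ∧ ((GenContFract.of v).contsAux n).b = b := by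
  induction n using Nat.strong_induction_on with
  | _ n ih =>
    match n with
    | 0 => exact ⟨1, 0, by simp [contsAux]⟩
    | 1 => exact ⟨⌊v⌋, 1, by simp [contsAux, of_h_eq_floor]⟩
    | n + 2 =>
      rcases hs : (GenContFract.of v).s.get? n with _ | gp
      · rw [contsAux_stable_step_of_terminated hs]
        exact ih (n + 1) (by omega)
      · obtain ⟨a, b, ha, hb⟩ := ih n (by omega)
        obtain ⟨a', b', ha', hb'⟩ := ih (n + 1) (by omega)
        obtain ⟨h1, z, hz⟩ := of_partNum_eq_one_and_exists_int_partDen_eq hs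
        rw [contsAux_recurrence hs rfl rfl]
        refine ⟨z * a' + a, z * b' + b, ?_, ?_⟩ <;> simp [h1, hz, ha, hb, ha', hb']

open GenContFract in
/-- Numerators and denominators of convergents are coprime, by the determinant formula. -/
lemma Irrational.isCoprime_nums_dens {α : ℝ} (hα : Irrational α) {n : ℕ} {p q : ℤ}
    (hp : (p : ℝ) = (GenContFract.of α).nums n) (hq : (q : ℝ) = (GenContFract.of α).dens n) :
    IsCoprime p q := by
  have ht : ¬ (GenContFract.of α).TerminatedAt n := fun h => hα <| by
    obtain ⟨x, hx⟩ := terminates_iff_rat α |>.1 ⟨n, h⟩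
    exact ⟨x, hx.symm⟩
  obtain ⟨a, b, ha, hb⟩ := exists_int_eq_contsAux α (n + 2)
  have hdet := SimpContFract.determinant (s := SimpContFract.of α) ht
  have hp' : ((SimpContFract.of α : GenContFract ℝ)).nums n = p := hp.symm
  have hq' : ((SimpContFract.of α : GenContFract ℝ)).dens n = q := hq.symm
  have ha' : ((SimpContFract.of α : GenContFract ℝ)).nums (n + 1) = a := ha
  have hb' : ((SimpContFract.of α : GenContFract ℝ)).dens (n + 1) = b := hb
  rw [hp', hq', ha', hb'] at hdet
  have hZ : p * b - q * a = (-1) ^ (n + 1) := by exact_mod_cast hdet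
  refine ⟨(-1) ^ (n + 1) * b, -(-1) ^ (n + 1) * a, ?_⟩
  have : ((-1 : ℤ) ^ (n + 1)) * (-1) ^ (n + 1) = 1 := by rw [← mul_pow]; simp
  linear_combination (-1) ^ (n + 1) * hZ + this

open GenContFract in
lemma IsSubseqOfConvergents.tendsto_atTop {α : ℝ} (hα : Irrational α) {p : ℕ → ℤ} {q : ℕ → ℕ}
    (h : IsSubseqOfConvergents α p q) : Tendsto q atTop atTop := by
  obtain ⟨k, hk, hpq⟩ := h
  have ht : ∀ n, ¬ (GenContFract.of α).TerminatedAt n := fun n h => hα <| by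
    obtain ⟨x, hx⟩ := terminates_iff_rat α |>.1 ⟨n, h⟩
    exact ⟨x, hx.symm⟩
  have hfib : ∀ n, Nat.fib (k n + 1) ≤ q n := fun n => by
    have := succ_nth_fib_le_of_nth_den (v := α) (n := k n) (Or.inr (ht _))
    rw [← (hpq n).2] at this
    exact_mod_cast this
  refine tendsto_atTop_mono (fun n => ?_) (tendsto_id.comp hk.tendsto_atTop)
  have := Nat.le_fib_add_one (k n + 1)
  have := hfib n
  simp only [Function.comp, id]
  omega

/-! ### Fourier coefficients on the circle -/

lemma UnitAddCircle.volume_eq_haarAddCircle :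
    (volume : Measure UnitAddCircle) = AddCircle.haarAddCircle := by
  rw [AddCircle.volume_eq_smul_haarAddCircle]; simp

lemma UnitAddCircle.fourier_coe (k : ℤ) (x : ℝ) :
    fourier k (x : UnitAddCircle) = Complex.exp (2 * Real.pi * (k * x) * Complex.I) := by
  rw [fourier_coe_apply]
  congr 1
  push_cast
  ring

lemma UnitAddCircle.fourier_norm_apply (k : ℤ) (x : UnitAddCircle) : ‖fourier k x‖ = 1 := by
  rw [fourier_apply, Circle.norm_coe]

lemma UnitAddCircle.fourier_nsmul (k : ℤ) (s : ℕ) (x : UnitAddCircle) :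
    fourier k (s • x) = fourier (s * k) x := by
  rw [fourier_apply, fourier_apply, mul_comm, mul_smul, natCast_zsmul]

lemma UnitAddCircle.measurePreserving_nsmul {s : ℕ} (hs : 0 < s) :
    MeasurePreserving (fun x : UnitAddCircle => s • x)
      AddCircle.haarAddCircle AddCircle.haarAddCircle := by
  simpa using Measure.measurePreserving_zsmul
    (AddCircle.haarAddCircle (T := (1 : ℝ))) (n := (s : ℤ)) (by exact_mod_cast hs.ne')

lemma integrable_haarAddCircle_of_continuous {φ : UnitAddCircle → ℂ} (hφ : Continuous φ) :
    Integrable φ AddCircle.haarAddCircle :=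
  hφ.integrable_of_hasCompactSupport (HasCompactSupport.of_compactSpace _)

lemma fourierHat_add {φ ψ : UnitAddCircle → ℝ} (hφ : Continuous φ) (hψ : Continuous ψ) (k : ℤ) :
    fourierHat (fun x => φ x + ψ x) k = fourierHat φ k + fourierHat ψ k := by
  have := congrFun (fourierCoeff.add (f := fun x : UnitAddCircle => (φ x : ℂ))
    (g := fun x : UnitAddCircle => (ψ x : ℂ))
    (integrable_haarAddCircle_of_continuous (by fun_prop))
    (integrable_haarAddCircle_of_continuous (by fun_prop))) k
  simp only [Pi.add_apply] at this
  rw [fourierHat, fourierHat, fourierHat, ← this]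
  congr 1
  ext x
  simp

lemma fourierHat_const_mul (c : ℝ) (φ : UnitAddCircle → ℝ) (k : ℤ) :
    fourierHat (fun x => c * φ x) k = c * fourierHat φ k := by
  simp only [fourierHat, Complex.ofReal_mul, fourierCoeff.const_mul]

lemma fourierHat_sum {ι : Type*} (s : Finset ι) {φ : ι → UnitAddCircle → ℝ}
    (hφ : ∀ i, Continuous (φ i)) (k : ℤ) :
    fourierHat (fun x => ∑ i ∈ s, φ i x) k = ∑ i ∈ s, fourierHat (φ i) k := by
  classical
  induction s using Finset.induction_on with
  | empty => simp [fourierHat, fourierCoeff]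
  | insert a s ha ih =>
    simp_rw [Finset.sum_insert ha]
    rw [fourierHat_add (hφ a) (by fun_prop), ih]

lemma fourierHat_comp_add (φ : UnitAddCircle → ℝ) (a : UnitAddCircle) (k : ℤ) :
    fourierHat (fun x => φ (x + a)) k = fourier k a * fourierHat φ k := by
  simp only [fourierHat, fourierCoeff]
  rw [← integral_add_right_eq_self (fun x : UnitAddCircle => fourier (-k) x • (φ x : ℂ)) a,
    ← integral_const_mul]
  refine integral_congr_ae (.of_forall fun x => ?_)
  have : fourier k a * fourier (-k) (x + a) = fourier (-k) x := by
    simp only [fourier_apply, ← Circle.coe_mul, ← AddCircle.toCircle_add]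
    congr 2
    rw [smul_add]
    module
  simp only [smul_eq_mul]
  rw [← mul_assoc, this]

lemma fourierHat_eq_zero_of_periodic {φ : UnitAddCircle → ℝ} {t : UnitAddCircle} {k : ℤ}
    (hφ : ∀ x, φ (x + t) = φ x) (ht : fourier k t ≠ 1) : fourierHat φ k = 0 := by
  have h := fourierHat_comp_add φ t k
  simp only [hφ] at h
  have : (fourier k t - 1) * fourierHat φ k = 0 := by linear_combination -h
  exact (mul_eq_zero.1 this).resolve_left (sub_ne_zero.2 ht)

lemma fourierHat_comp_nsmul_add {φ : UnitAddCircle → ℝ} (hφ : Continuous φ) {s : ℕ} (hs : 0 < s)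
    (h : UnitAddCircle) (k : ℤ) :
    fourierHat (fun x => φ (s • x + h)) (s * k) = fourier k h * fourierHat φ k := by
  rw [← fourierHat_comp_add]
  simp only [fourierHat, fourierCoeff]
  have hmp := UnitAddCircle.measurePreserving_nsmul hs
  have := integral_map (μ := AddCircle.haarAddCircle) hmp.aemeasurable
    (f := fun x : UnitAddCircle => fourier (-k) x • (φ (x + h) : ℂ))
    (Continuous.aestronglyMeasurable (by fun_prop))
  rw [hmp.map_eq] at this
  rw [this]
  simp_rw [UnitAddCircle.fourier_nsmul, mul_neg]

lemma norm_fourierHat_neg (φ : UnitAddCircle → ℝ) (k : ℤ) :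
    ‖fourierHat φ (-k)‖ = ‖fourierHat φ k‖ := by
  have : fourierHat φ (-k) = (starRingEnd ℂ) (fourierHat φ k) := by
    simp only [fourierHat, fourierCoeff]
    rw [← integral_conj]
    simp
  rw [this, Complex.norm_conj]

lemma fourierHat_zero (φ : UnitAddCircle → ℝ) : fourierHat φ 0 = ((∫ x, φ x : ℝ) : ℂ) := by
  simp only [fourierHat, fourierCoeff, UnitAddCircle.volume_eq_haarAddCircle]
  rw [← integral_complex_ofReal]
  simp

/-- A continuous function whose frequencies are the nonzero multiples of `q` is bounded by the sum
of the absolute values of its Fourier coefficients. -/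
lemma abs_le_two_mul_tsum_norm_fourierHat {F : UnitAddCircle → ℝ} (hF : Continuous F) {q : ℕ}
    (hq : 0 < q) (h0 : fourierHat F 0 = 0) (hdvd : ∀ k : ℤ, ¬ (q : ℤ) ∣ k → fourierHat F k = 0)
    (hsum : Summable fun k : ℕ+ => ‖fourierHat F (((k : ℕ) * q : ℕ) : ℤ)‖) (x : UnitAddCircle) :
    |F x| ≤ 2 * ∑' k : ℕ+, ‖fourierHat F (((k : ℕ) * q : ℕ) : ℤ)‖ := by
  set u : ℤ → ℝ := fun k => ‖fourierHat F (k * q)‖ with hu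
  have hu_even : u.Even := fun k => by
    simp only [hu, neg_mul, norm_fourierHat_neg]
  have hu_pnat : ∀ k : ℕ+, u k = ‖fourierHat F (((k : ℕ) * q : ℕ) : ℤ)‖ := fun k => by
    simp [hu]
  have hu_nat : Summable fun k : ℕ => u k := by
    rw [← summable_nat_add_iff 1]
    have := (summable_pnat_iff_summable_succ (f := fun k : ℕ => u k)).1 (by simpa [hu] using hsum)
    exact_mod_cast this
  have hu_sum : Summable u := by
    refine Summable.of_nat_of_neg hu_nat ?_
    simpa [hu_even _] using hu_nat
  have hinj : Function.Injective fun k : ℤ => k * (q : ℤ) :=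
    mul_left_injective₀ (by exact_mod_cast hq.ne')
  have hsupp : Function.support (fun k : ℤ => ‖fourierHat F k‖) ⊆
      Set.range fun k : ℤ => k * (q : ℤ) := by
    intro k hk
    by_contra hcon
    refine hk ?_
    simp only [norm_eq_zero]
    refine hdvd k fun ⟨m, hm⟩ => hcon ⟨m, by simp only [hm]; ring⟩
  have hall : Summable fun k : ℤ => ‖fourierHat F k‖ := by
    refine (hinj.summable_iff fun k hk => ?_).1 hu_sum
    by_contra hcon
    exact hk (hsupp hcon)
  have htsum : ∑' k : ℤ, ‖fourierHat F k‖ =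
      2 * ∑' k : ℕ+, ‖fourierHat F (((k : ℕ) * q : ℕ) : ℤ)‖ := by
    have h1 : ∑' k : ℤ, u k = ∑' k : ℤ, ‖fourierHat F k‖ := hinj.tsum_eq hsupp
    rw [← h1, tsum_int_eq_zero_add_two_mul_tsum_pnat hu_even hu_sum]
    simp [hu, h0]
  have hser := has_pointwise_sum_fourier_series_of_summable
    (f := (⟨fun x : UnitAddCircle => (F x : ℂ), by fun_prop⟩ : C(UnitAddCircle, ℂ)))
    (Summable.of_norm hall) x
  have hb := tsum_of_norm_bounded (E := ℂ) hall.hasSum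
    (f := fun i => fourierCoeff (fun x : UnitAddCircle => (F x : ℂ)) i • fourier i x) fun i => by
      rw [norm_smul, UnitAddCircle.fourier_norm_apply, mul_one]; rfl
  rw [← htsum, ← Real.norm_eq_abs, ← Complex.norm_real]
  have e := hser.tsum_eq
  simp only [ContinuousMap.coe_mk] at e
  rwa [e] at hb

/-! ### Birkhoff sums over rotations -/

lemma circleRotation_iterate (β : ℝ) (j : ℕ) (x : UnitAddCircle) :
    (circleRotation β)^[j] x = x + ((j * β : ℝ) : UnitAddCircle) := by
  induction j with
  | zero => simp
  | succ j ih =>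
    rw [Function.iterate_succ_apply', ih, circleRotation, add_assoc, ← AddCircle.coe_add]
    congr 2
    push_cast
    ring

lemma birkhoffSum_circleRotation (β : ℝ) (f : UnitAddCircle → ℝ) (N : ℕ) (x : UnitAddCircle) :
    birkhoffSum (circleRotation β) f N x =
      ∑ j ∈ Finset.range N, f (x + ((j * β : ℝ) : UnitAddCircle)) := by
  simp only [birkhoffSum, circleRotation_iterate]

lemma continuous_birkhoffSum_circleRotation {f : UnitAddCircle → ℝ} (hf : Continuous f) (β : ℝ)
    (N : ℕ) : Continuous (birkhoffSum (circleRotation β) f N) := by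
  have : birkhoffSum (circleRotation β) f N = fun x => _ :=
    funext (birkhoffSum_circleRotation β f N)
  rw [this]
  fun_prop

lemma birkhoffSum_circleRotation_mul (β : ℝ) (f : UnitAddCircle → ℝ) (N q : ℕ)
    (x : UnitAddCircle) :
    birkhoffSum (circleRotation β) f (N * q) x =
      birkhoffSum (circleRotation (q * β)) (birkhoffSum (circleRotation β) f q) N x := by
  induction N with
  | zero => simp
  | succ N ih =>
    rw [Nat.succ_mul, birkhoffSum_add, birkhoffSum_succ, ih, circleRotation_iterate,
      circleRotation_iterate]
    congr 4
    push_cast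
    ring

/-- Sums along `x ↦ x + α` of the function `x ↦ f^{(r)}(rx + h)` are sums of `f` along the same
rotation, evaluated at `rx + h`. -/
lemma birkhoffSum_comp_nsmul_add (α : ℝ) (f : UnitAddCircle → ℝ) (r m : ℕ) (h x : UnitAddCircle) :
    birkhoffSum (circleRotation α)
        (fun y => birkhoffSum (circleRotation α) f r (r • y + h)) m x =
      birkhoffSum (circleRotation α) f (m * r) (r • x + h) := by
  rw [birkhoffSum_circleRotation_mul, birkhoffSum_circleRotation, birkhoffSum_circleRotation]
  refine Finset.sum_congr rfl fun j _ => ?_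
  congr 1
  rw [smul_add, ← AddCircle.coe_nsmul, nsmul_eq_mul]
  have : (r * (j * α) : ℝ) = j * (r * α) := by ring
  rw [this]
  abel

lemma fourierHat_birkhoffSum {f : UnitAddCircle → ℝ} (hf : Continuous f) (β : ℝ) (N : ℕ)
    (k : ℤ) :
    fourierHat (birkhoffSum (circleRotation β) f N) k =
      (∑ j ∈ Finset.range N, fourier k ((j * β : ℝ) : UnitAddCircle)) * fourierHat f k := by
  have : birkhoffSum (circleRotation β) f N = fun x => _ :=
    funext (birkhoffSum_circleRotation β f N)
  rw [this, fourierHat_sum _ (fun j => by fun_prop), Finset.sum_mul]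
  exact Finset.sum_congr rfl fun j _ => fourierHat_comp_add f _ k

lemma fourier_inv_ne_one {q : ℕ} (hq : 0 < q) {k : ℤ} (hk : ¬ (q : ℤ) ∣ k) :
    fourier k (((1 / q : ℝ)) : UnitAddCircle) ≠ 1 := by
  rw [UnitAddCircle.fourier_coe, Ne, Complex.exp_eq_one_iff]
  rintro ⟨n, hn⟩
  refine hk ⟨n, ?_⟩
  have hq' : (q : ℂ) ≠ 0 := by exact_mod_cast hq.ne'
  have hpi := Complex.two_pi_I_ne_zero
  have h1 : (2 * Real.pi * Complex.I) * (k / q : ℂ) = (2 * Real.pi * Complex.I) * n := by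
    rw [mul_comm _ (n : ℂ), ← hn]
    push_cast
    ring
  have h2 := mul_left_cancel₀ hpi h1
  rw [div_eq_iff hq'] at h2
  have : (k : ℂ) = ((q * n : ℤ) : ℂ) := by rw [h2]; push_cast; ring
  exact_mod_cast this

/-- The sum of `f` over an orbit of length `q` of the rational rotation by `p / q`. -/
noncomputable def rationalSum (f : UnitAddCircle → ℝ) (p : ℤ) (q : ℕ) : UnitAddCircle → ℝ :=
  birkhoffSum (circleRotation (p / q)) f q

/-- The sum of `N` blocks, each being the sum over the rational rotation by `p / q`, started at
`x, x + qα, …, x + (N - 1)qα`. It approximates the Birkhoff sum of length `N * q` over the rotation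
by `α`, and only involves frequencies divisible by `q`. -/
noncomputable def blockSum (f : UnitAddCircle → ℝ) (α : ℝ) (p : ℤ) (q N : ℕ) : UnitAddCircle → ℝ :=
  birkhoffSum (circleRotation (q * α)) (rationalSum f p q) N

lemma continuous_rationalSum {f : UnitAddCircle → ℝ} (hf : Continuous f) (p : ℤ) (q : ℕ) :
    Continuous (rationalSum f p q) :=
  continuous_birkhoffSum_circleRotation hf _ _

lemma continuous_blockSum {f : UnitAddCircle → ℝ} (hf : Continuous f) (α : ℝ) (p : ℤ) (q N : ℕ) :
    Continuous (blockSum f α p q N) :=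
  continuous_birkhoffSum_circleRotation (continuous_rationalSum hf p q) _ _

/-- The orbit of length `q` under the rotation by `p / q` consists of all translates by multiples of
`1 / q`. -/
lemma rationalSum_add_inv (f : UnitAddCircle → ℝ) {p : ℤ} {q : ℕ} (hq : 0 < q)
    (hpq : IsCoprime p q) (x : UnitAddCircle) :
    rationalSum f p q (x + ((1 / q : ℝ) : UnitAddCircle)) = rationalSum f p q x := by
  have hq' : (q : ℝ) ≠ 0 := by exact_mod_cast hq.ne'
  have hint : ∀ z : ℤ, ((z : ℝ) : UnitAddCircle) = 0 := fun z => by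
    rw [AddCircle.coe_eq_zero_iff]; exact ⟨z, by simp⟩
  have hper : Function.Periodic (rationalSum f p q) ((p / q : ℝ) : UnitAddCircle) := fun x => by
    have h := birkhoffSum_apply_sub_birkhoffSum (circleRotation (p / q)) f q x
    rw [circleRotation_iterate, mul_div_cancel₀ _ hq', hint, add_zero, sub_self] at h
    exact sub_eq_zero.1 h
  obtain ⟨u, v, huv⟩ := hpq
  have huv' : (u : ℝ) * p + v * q = 1 := by exact_mod_cast huv
  have e : ((1 / q : ℝ) : UnitAddCircle) = u • ((p / q : ℝ) : UnitAddCircle) := by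
    rw [← AddCircle.coe_zsmul, ← sub_eq_zero, ← AddCircle.coe_sub, ← hint v]
    congr 1
    rw [zsmul_eq_mul]
    field_simp
    linarith
  rw [e]
  exact hper.zsmul u x

lemma blockSum_add_inv (f : UnitAddCircle → ℝ) (α : ℝ) {p : ℤ} {q : ℕ} (hq : 0 < q)
    (hpq : IsCoprime p q) (N : ℕ) (x : UnitAddCircle) :
    blockSum f α p q N (x + ((1 / q : ℝ) : UnitAddCircle)) = blockSum f α p q N x := by
  simp only [blockSum, birkhoffSum_circleRotation]
  refine Finset.sum_congr rfl fun j _ => ?_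
  rw [add_right_comm, rationalSum_add_inv f hq hpq]

lemma fourierHat_rationalSum_mul {f : UnitAddCircle → ℝ} (hf : Continuous f) (p : ℤ) {q : ℕ}
    (hq : 0 < q) (k : ℤ) :
    fourierHat (rationalSum f p q) (k * q) = q * fourierHat f (k * q) := by
  rw [rationalSum, fourierHat_birkhoffSum hf]
  congr 1
  have : ∀ j : ℕ, fourier (k * q) ((j * (p / q) : ℝ) : UnitAddCircle) = 1 := fun j => by
    rw [UnitAddCircle.fourier_coe, Complex.exp_eq_one_iff]
    refine ⟨k * j * p, ?_⟩
    have hq' : (q : ℂ) ≠ 0 := by exact_mod_cast hq.ne'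
    push_cast
    field_simp
  rw [Finset.sum_congr rfl fun j _ => this j]
  simp

lemma abs_rationalSum_le {f : UnitAddCircle → ℝ} (hf : Continuous f) (h0 : fourierHat f 0 = 0)
    {p : ℤ} {q : ℕ} (hq : 0 < q) (hpq : IsCoprime p q)
    (hsum : Summable fun k : ℕ+ => ‖fourierHat f (((k : ℕ) * q : ℕ) : ℤ)‖) (x : UnitAddCircle) :
    |rationalSum f p q x| ≤ 2 * (q * ∑' k : ℕ+, ‖fourierHat f (((k : ℕ) * q : ℕ) : ℤ)‖) := by
  have hk : ∀ k : ℕ+, ‖fourierHat (rationalSum f p q) (((k : ℕ) * q : ℕ) : ℤ)‖ =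
      q * ‖fourierHat f (((k : ℕ) * q : ℕ) : ℤ)‖ := fun k => by
    have := fourierHat_rationalSum_mul hf p hq (k : ℕ)
    push_cast at this ⊢
    rw [this, norm_mul, Complex.norm_natCast]
  rw [← tsum_mul_left]
  simp_rw [← hk]
  refine abs_le_two_mul_tsum_norm_fourierHat (continuous_rationalSum hf p q) hq ?_ ?_ ?_ x
  · have := fourierHat_rationalSum_mul hf p hq 0
    rw [zero_mul, h0, mul_zero] at this
    exact this
  · exact fun k hk => fourierHat_eq_zero_of_periodic (rationalSum_add_inv f hq hpq)
      (fourier_inv_ne_one hq hk)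
  · simp_rw [hk]
    exact hsum.mul_left _

lemma abs_birkhoffSum_le {f : UnitAddCircle → ℝ} {b : ℝ} (hf : ∀ x, |f x| ≤ b) (β : ℝ) (N : ℕ)
    (x : UnitAddCircle) : |birkhoffSum (circleRotation β) f N x| ≤ N * b := by
  rw [birkhoffSum_circleRotation]
  calc _ ≤ ∑ j ∈ Finset.range N, |f (x + ((j * β : ℝ) : UnitAddCircle))| :=
        Finset.abs_sum_le_sum_abs _ _
    _ ≤ ∑ _j ∈ Finset.range N, b := Finset.sum_le_sum fun j _ => hf _
    _ = N * b := by simp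

/-- Since `f` is Lipschitz, in each of the `N` blocks each of the `q` points `y + jα`, `j < q`,
can be replaced by `y + jp/q` at the cost of `K * j * |α - p / q|`. -/
lemma abs_birkhoffSum_sub_blockSum_le {f : UnitAddCircle → ℝ} {K : ℝ}
    (hK : ∀ (x : UnitAddCircle) (t : ℝ), |f (x + t) - f x| ≤ K * |t|) (α : ℝ) (p : ℤ) (q N : ℕ)
    (x : UnitAddCircle) :
    |birkhoffSum (circleRotation α) f (N * q) x - blockSum f α p q N x| ≤
      N * (q * (K * (|α - p / q| * q))) := by
  have hK0 : 0 ≤ K := by simpa using (abs_nonneg _).trans (hK 0 1)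
  rw [birkhoffSum_circleRotation_mul, blockSum, ← birkhoffSum_sub]
  refine abs_birkhoffSum_le (fun y => ?_) _ _ x
  rw [Pi.sub_apply, rationalSum, birkhoffSum_circleRotation, birkhoffSum_circleRotation,
    ← Finset.sum_sub_distrib]
  calc _ ≤ ∑ j ∈ Finset.range q, _ := Finset.abs_sum_le_sum_abs _ _
    _ ≤ ∑ _j ∈ Finset.range q, K * (|α - p / q| * q) := Finset.sum_le_sum fun j hj => by
        have h := hK (y + ((j * (p / q) : ℝ) : UnitAddCircle)) (j * (α - p / q))
        rw [add_assoc, ← AddCircle.coe_add, ← mul_add, add_sub_cancel] at h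
        refine h.trans (mul_le_mul_of_nonneg_left ?_ hK0)
        rw [abs_mul, Nat.abs_cast, mul_comm]
        gcongr
        exact (Finset.mem_range.1 hj).le
    _ = _ := by simp

/-- The frequency `q` survives in a block sum: the starting points of the blocks are multiples of
`qα`, where the character of frequency `q` is close to `1`. -/
lemma le_norm_fourierHat_blockSum {f : UnitAddCircle → ℝ} (hf : Continuous f) (α : ℝ) (p : ℤ)
    {q : ℕ} (hq : 0 < q) (N : ℕ) :
    N * q * ‖fourierHat f q‖ * (1 - 2 * Real.pi * (N * q * (|α - p / q| * q))) ≤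
      ‖fourierHat (blockSum f α p q N) q‖ := by
  have hq' : (q : ℝ) ≠ 0 := by exact_mod_cast hq.ne'
  have hterm : ∀ j ∈ Finset.range N,
      ‖fourier q ((j * (q * α) : ℝ) : UnitAddCircle) - 1‖ ≤
        2 * Real.pi * (N * q * (|α - p / q| * q)) := fun j hj => by
    have e : fourier q ((j * (q * α) : ℝ) : UnitAddCircle) =
        Complex.exp (Complex.I * ((2 * Real.pi * (j * q * ((α - p / q) * q)) : ℝ) : ℂ)) := by
      have hqC : (q : ℂ) ≠ 0 := by exact_mod_cast hq.ne'
      rw [UnitAddCircle.fourier_coe, Complex.exp_eq_exp_iff_exists_int]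
      refine ⟨j * q * p, ?_⟩
      push_cast
      field_simp
      ring
    rw [e]
    refine (Real.norm_exp_I_mul_ofReal_sub_one_le).trans ?_
    rw [Real.norm_eq_abs, abs_mul, abs_mul, abs_mul, abs_mul, abs_mul, Nat.abs_cast, Nat.abs_cast,
      abs_of_pos Real.pi_pos, abs_two]
    gcongr
    exact (Finset.mem_range.1 hj).le
  have hsumsub : ‖(∑ j ∈ Finset.range N, fourier q ((j * (q * α) : ℝ) : UnitAddCircle)) - N‖ ≤
      N * (2 * Real.pi * (N * q * (|α - p / q| * q))) := by
    have : (N : ℂ) = ∑ _j ∈ Finset.range N, 1 := by simp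
    rw [this, ← Finset.sum_sub_distrib]
    refine (norm_sum_le_of_le _ hterm).trans ?_
    simp
  have hlow : N * (1 - 2 * Real.pi * (N * q * (|α - p / q| * q))) ≤
      ‖∑ j ∈ Finset.range N, fourier q ((j * (q * α) : ℝ) : UnitAddCircle)‖ := by
    have h1 := norm_sub_norm_le (N : ℂ)
      (∑ j ∈ Finset.range N, fourier q ((j * (q * α) : ℝ) : UnitAddCircle))
    rw [norm_sub_rev, Complex.norm_natCast] at h1
    linarith
  have hhat : fourierHat (rationalSum f p q) q = q * fourierHat f q := by
    simpa using fourierHat_rationalSum_mul hf p hq 1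
  rw [blockSum, fourierHat_birkhoffSum (continuous_rationalSum hf p q), hhat, norm_mul, norm_mul,
    Complex.norm_natCast]
  calc _ = N * (1 - 2 * Real.pi * (N * q * (|α - p / q| * q))) * (q * ‖fourierHat f q‖) := by ring
    _ ≤ _ := by gcongr

/-! ### Continuously differentiable functions on the circle -/

lemma UnitAddCircle.continuous_of_lift {f : UnitAddCircle → ℝ}
    (hf : Continuous fun x : ℝ => f (x : UnitAddCircle)) : Continuous f :=
  QuotientAddGroup.isOpenQuotientMap_mk.isQuotientMap.continuous_iff.2 hf

lemma IsHolderClass.contDiff_one {f : UnitAddCircle → ℝ} {δ : ℝ} (hδ : 0 < δ)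
    (hf : IsHolderClass (1 + δ) f) : ContDiff ℝ 1 fun x : ℝ => f (x : UnitAddCircle) := by
  refine hf.1.of_le ?_
  have : 1 ≤ ⌊1 + δ⌋₊ := Nat.le_floor (by push_cast; linarith)
  exact_mod_cast this

lemma exists_continuous_hasDerivAt_lift {f : UnitAddCircle → ℝ}
    (hf : ContDiff ℝ 1 fun x : ℝ => f (x : UnitAddCircle)) :
    ∃ g : UnitAddCircle → ℝ, Continuous g ∧
      ∀ x : ℝ, HasDerivAt (fun x : ℝ => f (x : UnitAddCircle)) (g x) x := by
  have hper : Function.Periodic (deriv fun x : ℝ => f (x : UnitAddCircle)) 1 := fun x => by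
    rw [← deriv_comp_add_const]
    simp
  refine ⟨hper.lift, UnitAddCircle.continuous_of_lift ?_, fun x => ?_⟩
  · exact hf.continuous_deriv le_rfl
  · exact (hf.differentiable (by simp) x).hasDerivAt

lemma exists_forall_abs_add_sub_le {f : UnitAddCircle → ℝ}
    (hf : ContDiff ℝ 1 fun x : ℝ => f (x : UnitAddCircle)) :
    ∃ K, ∀ (x : UnitAddCircle) (t : ℝ), |f (x + t) - f x| ≤ K * |t| := by
  obtain ⟨g, hg, hfg⟩ := exists_continuous_hasDerivAt_lift hf
  obtain ⟨K, hK⟩ := isCompact_univ.exists_bound_of_continuousOn hg.continuousOn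
  refine ⟨K, fun x t => ?_⟩
  induction x using QuotientAddGroup.induction_on with
  | H x =>
    have := convex_univ.norm_image_sub_le_of_norm_hasDerivWithin_le (x := x) (y := x + t)
      (fun y _ => (hfg y).hasDerivWithinAt) (fun y _ => hK y trivial) trivial trivial
    simpa using this

lemma tendsto_norm_fourierHat_zero {g : UnitAddCircle → ℝ} (hg : Continuous g) :
    Tendsto (fun n : ℕ => ‖fourierHat g n‖) atTop (𝓝 0) := by
  let G : C(UnitAddCircle, ℂ) := ⟨fun x => (g x : ℂ), by fun_prop⟩
  have h := (hasSum_sq_fourierCoeff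
    (ContinuousMap.toLp (E := ℂ) 2 AddCircle.haarAddCircle ℂ G)).summable.tendsto_cofinite_zero
  simp_rw [fourierCoeff_toLp] at h
  have h2 := h.comp (Nat.cofinite_eq_atTop ▸ (Nat.cast_injective (R := ℤ)).tendsto_cofinite)
  have h3 := h2.sqrt
  simp only [Function.comp_def, Real.sqrt_zero, Real.sqrt_sq (norm_nonneg _)] at h3
  exact h3

lemma fourierHat_eq_fourierCoeffOn (f : UnitAddCircle → ℝ) (n : ℤ) :
    fourierHat f n =
      fourierCoeffOn (zero_lt_one' ℝ) (fun x : ℝ => (f (x : UnitAddCircle) : ℂ)) n := by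
  rw [fourierHat, fourierCoeff_eq_intervalIntegral _ n 0, fourierCoeffOn_eq_integral]
  simp only [zero_add, sub_zero, fourier_coe_apply]

/-- The Fourier coefficients of a `C¹` function are `o(1 / n)`. -/
lemma tendsto_mul_norm_fourierHat_zero {f : UnitAddCircle → ℝ}
    (hf : ContDiff ℝ 1 fun x : ℝ => f (x : UnitAddCircle)) :
    Tendsto (fun n : ℕ => (n : ℝ) * ‖fourierHat f n‖) atTop (𝓝 0) := by
  obtain ⟨g, hg, hfg⟩ := exists_continuous_hasDerivAt_lift hf
  refine squeeze_zero (fun n => by positivity) (fun n => ?_) (tendsto_norm_fourierHat_zero hg)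
  rcases Nat.eq_zero_or_pos n with rfl | hn
  · simp
  have hgc : Continuous fun x : ℝ => (g (x : UnitAddCircle) : ℂ) :=
    Complex.continuous_ofReal.comp (hg.comp (AddCircle.continuous_mk' 1))
  have h := fourierCoeffOn_of_hasDerivAt (zero_lt_one' ℝ) (n := (n : ℤ)) (by omega)
    (f := fun x : ℝ => (f (x : UnitAddCircle) : ℂ)) (f' := fun x : ℝ => (g (x : UnitAddCircle) : ℂ))
    (fun x _ => (hfg x).ofReal_comp) (hgc.intervalIntegrable _ _)
  have h01 : ((1 : ℝ) : UnitAddCircle) = ((0 : ℝ) : UnitAddCircle) := by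
    simp
  rw [← fourierHat_eq_fourierCoeffOn, ← fourierHat_eq_fourierCoeffOn, h01, sub_self, mul_zero,
    zero_sub, Complex.ofReal_one, Complex.ofReal_zero, sub_zero, one_mul] at h
  have hn' : (0 : ℝ) < n := by exact_mod_cast hn
  rw [h, norm_mul, norm_neg]
  have : ‖(1 : ℂ) / (-2 * Real.pi * Complex.I * (n : ℤ))‖ = 1 / (2 * Real.pi * n) := by
    simp [abs_of_pos Real.pi_pos]
  rw [this]
  have : (n : ℝ) * (1 / (2 * Real.pi * n) * ‖fourierHat g n‖) =
      1 / (2 * Real.pi) * ‖fourierHat g n‖ := by field_simp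
  rw [this]
  refine mul_le_of_le_one_left (norm_nonneg _) ?_
  rw [div_le_one (by positivity)]
  linarith [Real.pi_gt_three]

/-! ### Coboundaries over rotations -/

/-- Translations act continuously in `L¹` of the circle. -/
lemma tendsto_integral_norm_comp_add_sub {u : UnitAddCircle → ℂ}
    (hu : Integrable u AddCircle.haarAddCircle) {t : ℕ → UnitAddCircle}
    (ht : Tendsto t atTop (𝓝 0)) :
    Tendsto (fun n => ∫ x, ‖u (x + t n) - u x‖ ∂AddCircle.haarAddCircle) atTop (𝓝 0) := by
  rw [Metric.tendsto_nhds]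
  intro ε hε
  obtain ⟨g, -, hug, hg, -⟩ :=
    hu.exists_hasCompactSupport_integral_sub_le (ε := ε / 4) (by positivity)
  have hunif := CompactSpace.uniformContinuous_of_continuous hg
  obtain ⟨d, hd, hgd⟩ := Metric.uniformContinuous_iff.1 hunif (ε / 4) (by positivity)
  filter_upwards [Metric.tendsto_nhds.1 ht d hd] with n hn
  have hgi := integrable_haarAddCircle_of_continuous hg
  have hug_add : ∫ x, ‖u (x + t n) - g (x + t n)‖ ∂AddCircle.haarAddCircle ≤ ε / 4 := by
    rw [integral_add_right_eq_self (fun x : UnitAddCircle => ‖u x - g x‖)]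
    exact hug
  have hi1 : Integrable (fun x => ‖u (x + t n) - g (x + t n)‖) AddCircle.haarAddCircle :=
    ((hu.sub hgi).comp_add_right (t n)).norm
  have hi2 : Integrable (fun x => ‖u x - g x‖) AddCircle.haarAddCircle := (hu.sub hgi).norm
  have hi3 : Integrable (fun x => ‖u (x + t n) - g (x + t n)‖ + ε / 4) AddCircle.haarAddCircle :=
    hi1.add (integrable_const _)
  rw [Real.dist_0_eq_abs, abs_of_nonneg (integral_nonneg fun x => norm_nonneg _)]
  calc ∫ x, ‖u (x + t n) - u x‖ ∂AddCircle.haarAddCircle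
      ≤ ∫ x, (‖u (x + t n) - g (x + t n)‖ + ε / 4 + ‖u x - g x‖) ∂AddCircle.haarAddCircle := by
        refine integral_mono ((hu.comp_add_right _).sub hu).norm (hi3.add hi2) fun x => ?_
        have h1 : dist (g (x + t n)) (g x) < ε / 4 := hgd <| by
          rwa [dist_eq_norm, add_sub_cancel_left, ← dist_zero_right]
        rw [dist_eq_norm] at h1
        have e : u (x + t n) - u x =
          (u (x + t n) - g (x + t n)) + (g (x + t n) - g x) - (u x - g x) := by ring
        simp only
        rw [e]
        refine (norm_sub_le _ _).trans ?_
        gcongr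
        refine (norm_add_le _ _).trans ?_
        gcongr
    _ ≤ ε / 4 + ε / 4 + ε / 4 := by
        rw [integral_add hi3 hi2,
          integral_add hi1 (integrable_const _)]
        simp only [integral_const, probReal_univ, one_smul]
        gcongr
    _ < ε := by linarith

lemma ae_prod_iterate_eq_of_coboundary {X G : Type*} [MeasurableSpace X] [CommGroup G]
    {μ : Measure X} {T : X → X} (hT : MeasurePreserving T μ μ) {φ ξ : X → G}
    (h : ∀ᵐ x ∂μ, φ x = ξ x * (ξ (T x))⁻¹) (m : ℕ) :
    ∀ᵐ x ∂μ, ∏ j ∈ Finset.range m, φ (T^[j] x) = ξ x * (ξ (T^[m] x))⁻¹ := by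
  induction m with
  | zero => simp
  | succ m ih =>
    filter_upwards [ih, (hT.iterate m).quasiMeasurePreserving.ae h] with x hx hm
    rw [Finset.prod_range_succ, hx, hm, Function.iterate_succ_apply']
    group

/-- If `φ` is a coboundary over the rotation by `α`, then its iterated products along times `m n`
with `m n * α → 0` modulo `1` tend to `1` in `L¹`. -/
lemma IsCoboundary.tendsto_integral_norm_prod_sub_one {α : ℝ} {φ : UnitAddCircle → Circle}
    (h : IsCoboundary volume (circleRotation α) φ) {m : ℕ → ℕ}
    (hm : Tendsto (fun n => ((m n * α : ℝ) : UnitAddCircle)) atTop (𝓝 0)) :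
    Tendsto (fun n => ∫ x, ‖((∏ j ∈ Finset.range (m n), φ ((circleRotation α)^[j] x) : Circle) : ℂ)
      - 1‖ ∂AddCircle.haarAddCircle) atTop (𝓝 0) := by
  obtain ⟨ξ, hξ, hφ⟩ := h
  let _ : MeasurableSpace Circle := borel Circle
  have _ : BorelSpace Circle := ⟨rfl⟩
  rw [UnitAddCircle.volume_eq_haarAddCircle] at hφ
  have hcoe : Continuous fun z : Circle => (z : ℂ) := by fun_prop
  have hu : Integrable (fun x => (ξ x : ℂ)) (AddCircle.haarAddCircle (T := (1 : ℝ))) :=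
    Integrable.of_bound (C := 1)
      (hcoe.measurable.comp hξ).aestronglyMeasurable (.of_forall fun x => (Circle.norm_coe _).le)
  have hT : MeasurePreserving (circleRotation α) AddCircle.haarAddCircle AddCircle.haarAddCircle :=
    measurePreserving_add_right _ _
  refine (tendsto_integral_norm_comp_add_sub hu hm).congr fun n => integral_congr_ae ?_
  filter_upwards [ae_prod_iterate_eq_of_coboundary hT hφ (m n)] with x hx
  rw [hx, circleRotation_iterate, Circle.coe_mul, Circle.coe_inv]
  set a := ξ x
  set b := ξ (x + ((m n * α : ℝ) : UnitAddCircle))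
  have hb : (b : ℂ) ≠ 0 := Circle.coe_ne_zero b
  have : (a : ℂ) * (b : ℂ)⁻¹ - 1 = -((b : ℂ) - a) * (b : ℂ)⁻¹ := by field_simp; ring
  rw [this, norm_mul, norm_neg, norm_inv, Circle.norm_coe, inv_one, mul_one]

lemma integral_fourier_neg_eq_zero {k : ℤ} (hk : k ≠ 0) :
    ∫ x : UnitAddCircle, fourier (-k) x ∂AddCircle.haarAddCircle = 0 := by
  have := congrFun (fourierCoeff_fourier (T := (1 : ℝ)) 0) k
  simpa [fourierCoeff, hk, -fourier_apply, fourier_zero] using this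

/-- A small real function `G` has small Fourier coefficients as soon as a constant multiple of
`exp (2πiG)` is close to `1` in mean. Here `E` is a uniform approximation of `G`, and the quadratic
term bounds the remainder of the linearisation of the exponential. -/
lemma two_pi_mul_norm_fourierHat_le {E G : UnitAddCircle → ℝ} (hE : Continuous E)
    (hG : Continuous G) {b η : ℝ} (hGb : ∀ x, |G x| ≤ b) (hb : 2 * Real.pi * b ≤ 1)
    (hEG : ∀ x, |E x - G x| ≤ η) (w : Circle) {k : ℤ} (hk : k ≠ 0) :
    2 * Real.pi * ‖fourierHat G k‖ ≤
      (∫ x, ‖((w * Circle.exp (2 * Real.pi * E x) : Circle) : ℂ) - 1‖ ∂AddCircle.haarAddCircle) +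
        2 * Real.pi * η + (2 * Real.pi * b) ^ 2 := by
  have hpi := Real.pi_pos
  set v : UnitAddCircle → ℂ := fun x => (Circle.exp (2 * Real.pi * E x) : ℂ) with hv
  have hvc : Continuous v := by fun_prop
  have hw : (w : ℂ) ≠ 0 := Circle.coe_ne_zero w
  have hvw : ∀ x, ‖v x - (w : ℂ)⁻¹‖ =
      ‖((w * Circle.exp (2 * Real.pi * E x) : Circle) : ℂ) - 1‖ := fun x => by
    have : ((w * Circle.exp (2 * Real.pi * E x) : Circle) : ℂ) - 1 = w * (v x - (w : ℂ)⁻¹) := by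
      rw [mul_sub, mul_inv_cancel₀ hw, Circle.coe_mul]
    rw [this, norm_mul, Circle.norm_coe, one_mul]
  simp_rw [← hvw]
  have hlin : ∀ x, ‖v x - 1 - 2 * Real.pi * Complex.I * G x‖ ≤
      2 * Real.pi * η + (2 * Real.pi * b) ^ 2 := fun x => by
    set y : ℂ := Complex.I * ((2 * Real.pi * G x : ℝ) : ℂ) with hy
    have hyn : ‖y‖ ≤ 2 * Real.pi * b := by
      rw [hy, norm_mul, Complex.norm_I, one_mul, Complex.norm_real, Real.norm_eq_abs, abs_mul,
        abs_of_pos (by positivity : 0 < 2 * Real.pi)]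
      exact mul_le_mul_of_nonneg_left (hGb x) (by positivity)
    have h1 : ‖Complex.exp y - 1 - y‖ ≤ (2 * Real.pi * b) ^ 2 :=
      (Complex.norm_exp_sub_one_sub_id_le (hyn.trans hb)).trans
        (pow_le_pow_left₀ (norm_nonneg _) hyn 2)
    have hvx : v x = Complex.exp ((2 * Real.pi * E x : ℝ) * Complex.I) := Circle.coe_exp _
    have h2 : ‖v x - Complex.exp y‖ ≤ 2 * Real.pi * η := by
      have e : v x - Complex.exp y = Complex.exp y *
          (Complex.exp (Complex.I * ((2 * Real.pi * (E x - G x) : ℝ) : ℂ)) - 1) := by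
        rw [mul_sub, ← Complex.exp_add, mul_one, hvx, hy]
        congr 2
        push_cast
        ring
      rw [e, norm_mul, hy, mul_comm Complex.I, Complex.norm_exp_ofReal_mul_I, one_mul]
      refine Real.norm_exp_I_mul_ofReal_sub_one_le.trans ?_
      rw [Real.norm_eq_abs, abs_mul, abs_of_pos (by positivity : 0 < 2 * Real.pi)]
      exact mul_le_mul_of_nonneg_left (hEG x) (by positivity)
    have e : v x - 1 - 2 * Real.pi * Complex.I * G x =
        (v x - Complex.exp y) + (Complex.exp y - 1 - y) := by
      rw [hy]; push_cast; ring
    rw [e]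
    exact (norm_add_le _ _).trans (add_le_add h2 h1)
  have hi : ∀ {F : UnitAddCircle → ℂ}, Continuous F →
      Integrable F AddCircle.haarAddCircle := integrable_haarAddCircle_of_continuous
  have hfc : Continuous fun x : UnitAddCircle => fourier (-k) x := map_continuous _
  -- Constants integrate to zero against a nontrivial character.
  have key : 2 * Real.pi * Complex.I * fourierHat G k =
      (∫ x, fourier (-k) x * (v x - (w : ℂ)⁻¹) ∂AddCircle.haarAddCircle) -
        ∫ x, fourier (-k) x * (v x - 1 - 2 * Real.pi * Complex.I * G x)
          ∂AddCircle.haarAddCircle := by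
    rw [← integral_sub (hi (by fun_prop)) (hi (by fun_prop)), fourierHat, fourierCoeff,
      ← integral_const_mul]
    have e : ∀ x : UnitAddCircle, fourier (-k) x * (v x - (w : ℂ)⁻¹) -
        fourier (-k) x * (v x - 1 - 2 * Real.pi * Complex.I * G x) =
        2 * Real.pi * Complex.I * (fourier (-k) x • (G x : ℂ)) +
          (1 - (w : ℂ)⁻¹) * fourier (-k) x := fun x => by
      rw [smul_eq_mul]; ring
    simp_rw [e]
    rw [integral_add (hi (by fun_prop)) (hi (by fun_prop)),
      integral_const_mul (1 - (w : ℂ)⁻¹), integral_fourier_neg_eq_zero hk, mul_zero, add_zero]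
  have hnorm : 2 * Real.pi * ‖fourierHat G k‖ = ‖2 * Real.pi * Complex.I * fourierHat G k‖ := by
    simp [abs_of_pos hpi]
  rw [hnorm, key, add_assoc]
  refine (norm_sub_le _ _).trans (add_le_add ?_ ?_)
  · refine (norm_integral_le_integral_norm _).trans_eq ?_
    simp_rw [norm_mul, UnitAddCircle.fourier_norm_apply, one_mul]
  · have := norm_integral_le_of_norm_le_const (μ := AddCircle.haarAddCircle (T := (1 : ℝ)))
      (f := fun x : UnitAddCircle =>
        fourier (-k) x * (v x - 1 - 2 * Real.pi * Complex.I * G x))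
      (C := 2 * Real.pi * η + (2 * Real.pi * b) ^ 2) (.of_forall fun x => by
        rw [norm_mul, UnitAddCircle.fourier_norm_apply, one_mul]; exact hlin x)
    simpa only [probReal_univ, mul_one] using this

/-! ### The cocycle along multiples of the denominators -/

lemma prod_twistedCocycle_iterate (α : ℝ) (f : UnitAddCircle → ℝ) (r s : ℕ) (z : Circle)
    (h A B : ℝ) (m : ℕ) (x : UnitAddCircle) :
    ∏ j ∈ Finset.range m, twistedCocycle α f r s z h A B ((circleRotation α)^[j] x) =
      z ^ m * Circle.exp (2 * Real.pi *
        (A * birkhoffSum (circleRotation α) f (m * r) (r • x) +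
          B * birkhoffSum (circleRotation α) f (m * s) (s • x + (h : UnitAddCircle)))) := by
  have hr := birkhoffSum_comp_nsmul_add α f r m 0 x
  simp only [add_zero] at hr
  rw [← hr, ← birkhoffSum_comp_nsmul_add]
  clear hr
  induction m with
  | zero => simp
  | succ m ih =>
    rw [Finset.prod_range_succ, ih, birkhoffSum_succ, birkhoffSum_succ, twistedCocycle, pow_succ,
      mul_mul_mul_comm, ← Circle.exp_add]
    congr 2
    ring

/-- The approximation of `x ↦ A f^{(rm)}(rx) + B f^{(sm)}(sx + h)`, `m = l * q`, by block sums. -/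
noncomputable def twistedBlockSum (α : ℝ) (f : UnitAddCircle → ℝ) (r s : ℕ) (h A B : ℝ) (p : ℤ)
    (q l : ℕ) (x : UnitAddCircle) : ℝ :=
  A * blockSum f α p q (r * l) (r • x) +
    B * blockSum f α p q (s * l) (s • x + (h : UnitAddCircle))

section TwistedBlockSum

variable {α : ℝ} {f : UnitAddCircle → ℝ} {r s : ℕ} {h A B : ℝ} {p : ℤ} {q l : ℕ}

lemma continuous_twistedBlockSum (hf : Continuous f) :
    Continuous (twistedBlockSum α f r s h A B p q l) := by
  have h1 := continuous_blockSum hf α p q (r * l)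
  have h2 := continuous_blockSum hf α p q (s * l)
  unfold twistedBlockSum
  fun_prop

lemma abs_birkhoffSum_sub_twistedBlockSum_le {K : ℝ}
    (hK : ∀ (x : UnitAddCircle) (t : ℝ), |f (x + t) - f x| ≤ K * |t|) (x : UnitAddCircle) :
    |A * birkhoffSum (circleRotation α) f (l * q * r) (r • x) +
        B * birkhoffSum (circleRotation α) f (l * q * s) (s • x + (h : UnitAddCircle)) -
        twistedBlockSum α f r s h A B p q l x| ≤
      (|A| * r + |B| * s) * K * (l * q * (|α - p / q| * q)) := by
  have h1 := abs_birkhoffSum_sub_blockSum_le hK α p q (r * l) (r • x)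
  have h2 := abs_birkhoffSum_sub_blockSum_le hK α p q (s * l) (s • x + (h : UnitAddCircle))
  rw [show l * q * r = r * l * q by ring, show l * q * s = s * l * q by ring, twistedBlockSum,
    add_sub_add_comm, ← mul_sub, ← mul_sub]
  refine (abs_add_le _ _).trans ?_
  rw [abs_mul, abs_mul]
  refine (add_le_add (mul_le_mul_of_nonneg_left h1 (abs_nonneg A))
    (mul_le_mul_of_nonneg_left h2 (abs_nonneg B))).trans_eq ?_
  push_cast
  ring

lemma abs_twistedBlockSum_le (hf : Continuous f) (h0 : fourierHat f 0 = 0) (hq : 0 < q)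
    (hpq : IsCoprime p q)
    (hsum : Summable fun k : ℕ+ => ‖fourierHat f (((k : ℕ) * q : ℕ) : ℤ)‖) (x : UnitAddCircle) :
    |twistedBlockSum α f r s h A B p q l x| ≤ 2 * (|A| * r + |B| * s) *
      (l * q * ∑' k : ℕ+, ‖fourierHat f (((k : ℕ) * q : ℕ) : ℤ)‖) := by
  have hb := fun N : ℕ => abs_birkhoffSum_le (abs_rationalSum_le hf h0 hq hpq hsum) (q * α) N
  have h1 := hb (r * l) (r • x)
  have h2 := hb (s * l) (s • x + (h : UnitAddCircle))
  rw [twistedBlockSum, blockSum, blockSum]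
  refine (abs_add_le _ _).trans ?_
  rw [abs_mul, abs_mul]
  refine (add_le_add (mul_le_mul_of_nonneg_left h1 (abs_nonneg A))
    (mul_le_mul_of_nonneg_left h2 (abs_nonneg B))).trans_eq ?_
  push_cast
  ring

/-- The frequency `s * q` is absent from `x ↦ blockSum (r • x)`, because `s < r`. -/
lemma norm_fourierHat_twistedBlockSum_eq (hf : Continuous f) (hs : 0 < s) (hsr : s < r)
    (hq : 0 < q) (hpq : IsCoprime p q) :
    ‖fourierHat (twistedBlockSum α f r s h A B p q l) (s * q)‖ =
      |B| * ‖fourierHat (blockSum f α p q (s * l)) q‖ := by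
  have h1 := continuous_blockSum hf α p q (r * l)
  have h2 := continuous_blockSum hf α p q (s * l)
  have hrq : 0 < r * q := Nat.mul_pos (hs.trans hsr) hq
  have hz : fourierHat (fun x => blockSum f α p q (r * l) (r • x)) (s * q) = 0 := by
    refine fourierHat_eq_zero_of_periodic (t := ((1 / (r * q : ℕ) : ℝ) : UnitAddCircle))
      (fun x => ?_) (fourier_inv_ne_one hrq fun hdvd => ?_)
    · rw [smul_add, ← AddCircle.coe_nsmul]
      have : r • (1 / (r * q : ℕ) : ℝ) = 1 / q := by
        have : (r : ℝ) ≠ 0 := by exact_mod_cast (hs.trans hsr).ne'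
        rw [nsmul_eq_mul]
        push_cast
        field_simp
      rw [this, blockSum_add_inv f α hq hpq]
    · have : r * q ∣ s * q := by exact_mod_cast hdvd
      exact absurd (Nat.le_of_dvd hs (Nat.dvd_of_mul_dvd_mul_right hq this)) (by omega)
  unfold twistedBlockSum
  rw [fourierHat_add (by fun_prop) (by fun_prop), fourierHat_const_mul, fourierHat_const_mul, hz,
    fourierHat_comp_nsmul_add h2 hs, mul_zero, zero_add, norm_mul, norm_mul,
    UnitAddCircle.fourier_norm_apply, one_mul, Complex.norm_real, Real.norm_eq_abs]

lemma norm_fourierHat_twistedBlockSum_zero (hf : Continuous f) (hr : 0 < r) :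
    ‖fourierHat (twistedBlockSum α f r s h A 0 p q l) (r * q)‖ =
      |A| * ‖fourierHat (blockSum f α p q (r * l)) q‖ := by
  have h1 := fourierHat_comp_nsmul_add (continuous_blockSum hf α p q (r * l)) hr 0 q
  simp only [add_zero] at h1
  unfold twistedBlockSum
  simp only [zero_mul, add_zero]
  rw [fourierHat_const_mul, h1, norm_mul, norm_mul,
    UnitAddCircle.fourier_norm_apply, one_mul, Complex.norm_real, Real.norm_eq_abs]

end TwistedBlockSum

/-- Some nonzero frequency of `twistedBlockSum` carries a coefficient comparable to
`l * q * ‖fourierHat f q‖`: it is `s * q` when `B ≠ 0`, and `r * q` when `B = 0`. -/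
lemma exists_le_norm_fourierHat_twistedBlockSum {f : UnitAddCircle → ℝ} (hf : Continuous f)
    {r s : ℕ} (hs : 0 < s) (hsr : s < r) {A B : ℝ} (hAB : A ^ 2 + B ^ 2 ≠ 0) (α h : ℝ) :
    ∃ d > 0, ∃ t : ℕ, ∀ (p : ℤ) (q l : ℕ), 0 < q → IsCoprime p q → ∃ k : ℤ, k ≠ 0 ∧
      d * (l * q * ‖fourierHat f q‖) * (1 - 2 * Real.pi * (t * (l * q * (|α - p / q| * q)))) ≤
        ‖fourierHat (twistedBlockSum α f r s h A B p q l) k‖ := by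
  by_cases hB : B = 0
  · subst hB
    have hA : A ≠ 0 := by rintro rfl; simp at hAB
    have hr : 0 < r := hs.trans hsr
    refine ⟨|A| * r, by positivity, r, fun p q l hq _ => ⟨r * q, by positivity, ?_⟩⟩
    rw [norm_fourierHat_twistedBlockSum_zero hf hr]
    refine le_trans (le_of_eq ?_) (mul_le_mul_of_nonneg_left
      (le_norm_fourierHat_blockSum hf α p hq (r * l)) (abs_nonneg A))
    push_cast
    ring
  · refine ⟨|B| * s, by positivity, s, fun p q l hq hpq => ⟨s * q, by positivity, ?_⟩⟩
    rw [norm_fourierHat_twistedBlockSum_eq hf hs hsr hq hpq]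
    refine le_trans (le_of_eq ?_) (mul_le_mul_of_nonneg_left
      (le_norm_fourierHat_blockSum hf α p hq (s * l)) (abs_nonneg B))
    push_cast
    ring

/-- A lower bound on the ratio `a / ∑ u` includes the summability of `u`, since the sum of a
non-summable family is `0` and so is a quotient by `0`. -/
lemma summable_and_tsum_le_of_lt_div {ι : Type*} {u : ι → ℝ} (hu : ∀ i, 0 ≤ u i) {a c : ℝ}
    (hc : 0 < c) (h : c < a / ∑' i, u i) : Summable u ∧ ∑' i, u i ≤ a / c ∧ 0 < a := by
  have hne : ∑' i, u i ≠ 0 := by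
    intro h0
    rw [h0, div_zero] at h
    exact lt_asymm h hc
  have hpos : 0 < ∑' i, u i := lt_of_le_of_ne (tsum_nonneg hu) hne.symm
  have hlt := (lt_div_iff₀ hpos).1 h
  refine ⟨?_, ?_, (mul_pos hc hpos).trans hlt⟩
  · by_contra hns
    exact hne (tsum_eq_zero_of_not_summable hns)
  · rw [le_div_iff₀ hc, mul_comm]
    exact hlt.le

theorem mainTheorem3
    (α : ℝ) (hα : Irrational α)
    (f : UnitAddCircle → ℝ) (δ : ℝ) (hδ : 0 < δ) (hf : IsHolderClass (1 + δ) f)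
    (hmean : ∫ x, f x = 0)
    (r s : ℕ) (hs : 0 < s) (hsr : s < r) (hcop : Nat.Coprime r s)
    (p : ℕ → ℤ) (q : ℕ → ℕ) (hpq : IsSubseqOfConvergents α p q)
    (c₀ : ℝ) (hc₀ : 0 < c₀)
    (h28a : ∀ n, c₀ < ‖fourierHat f (q n)‖ /
      ∑' k : ℕ+, ‖fourierHat f (((k : ℕ) * q n : ℕ) : ℤ)‖)
    (h28b : ∀ n, s ∣ q n → c₀ < ‖fourierHat f (q n)‖ /
      (‖fourierHat f (q n)‖ +
        ∑' k : ℕ+, ‖fourierHat f (((k : ℕ) * (r * (q n / s)) : ℕ) : ℤ)‖))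
    (h29a : Tendsto (fun n => |α - (p n : ℝ) / (q n : ℝ)| * (q n : ℝ) / ‖fourierHat f (q n)‖)
      atTop (𝓝 0)) :
    ∀ (z : Circle) (h A B : ℝ), A ^ 2 + B ^ 2 ≠ 0 →
      ¬ IsCoboundary volume (circleRotation α) (twistedCocycle α f r s z h A B) := by
  intro z h A B hAB hcob
  have hpi := Real.pi_pos
  have hf1 := hf.contDiff_one hδ
  have hfc : Continuous f := UnitAddCircle.continuous_of_lift hf1.continuous
  have hf0 : fourierHat f 0 = 0 := by rw [fourierHat_zero, hmean, Complex.ofReal_zero]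
  obtain ⟨K, hK⟩ := exists_forall_abs_add_sub_le hf1
  obtain ⟨d, hd, t, hdt⟩ := exists_le_norm_fourierHat_twistedBlockSum hfc hs hsr hAB α h
  set a : ℕ → ℝ := fun n => ‖fourierHat f (q n)‖ with ha
  set ρ : ℕ → ℝ := fun n => |α - (p n : ℝ) / (q n : ℝ)| * (q n : ℝ) / a n with hρ
  have h28 := fun n => summable_and_tsum_le_of_lt_div (fun k => norm_nonneg _) hc₀ (h28a n)
  have ha_pos : ∀ n, 0 < a n := fun n => (h28 n).2.2
  have hq_pos : ∀ n, 0 < q n := fun n => Nat.pos_of_ne_zero fun h0 => by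
    have := ha_pos n
    simp [ha, h0, hf0] at this
  have hcopr : ∀ n, IsCoprime (p n) (q n : ℤ) := fun n => by
    obtain ⟨k, -, hk⟩ := hpq
    exact hα.isCoprime_nums_dens (hk n).1 (by simpa using (hk n).2)
  have hρ_nonneg : ∀ n, 0 ≤ ρ n := fun n => by positivity
  have hρ_mul : ∀ n, |α - (p n : ℝ) / (q n : ℝ)| * (q n : ℝ) = a n * ρ n := fun n => by
    rw [hρ]
    field_simp [(ha_pos n).ne']
  have hqa : Tendsto (fun n => (q n : ℝ) * a n) atTop (𝓝 0) :=
    (tendsto_mul_norm_fourierHat_zero hf1).comp (hpq.tendsto_atTop hα)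
  -- `W` collects the size of the two summands. The constant `c` is chosen such that the quadratic
  -- error of the linearised exponential stays below the linear term.
  set W : ℝ := |A| * r + |B| * s with hW
  have hW0 : 0 ≤ W := by positivity
  set M : ℝ := 2 * W / c₀ + 1 with hM
  have hM_pos : 0 < M := by positivity
  set c : ℝ := min (1 / (2 * Real.pi * M)) (d / (16 * Real.pi * M ^ 2)) with hc
  have hc_pos : 0 < c := by positivity
  have hc1 : 2 * Real.pi * (M * c) ≤ 1 := by
    have : c ≤ 1 / (2 * Real.pi * M) := min_le_left _ _
    rw [le_div_iff₀ (by positivity)] at this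
    linarith
  have hc2 : (2 * Real.pi * (M * c)) ^ 2 ≤ Real.pi * d * c / 4 := by
    have h1 : c ≤ d / (16 * Real.pi * M ^ 2) := min_le_right _ _
    rw [le_div_iff₀ (by positivity)] at h1
    have h2 := mul_le_mul_of_nonneg_left h1 (by positivity : 0 ≤ Real.pi * c / 4)
    linarith
  set l : ℕ → ℕ := fun n => ⌊c / (q n * a n)⌋₊ with hl
  have hqa_pos : ∀ n, 0 < q n * a n := fun n =>
    mul_pos (by exact_mod_cast hq_pos n) (ha_pos n)
  have hl_le : ∀ n, l n * q n * a n ≤ c := fun n => by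
    rw [mul_assoc, ← le_div_iff₀ (hqa_pos n)]
    exact Nat.floor_le (div_nonneg hc_pos.le (hqa_pos n).le)
  have hl_ge : ∀ᶠ n in atTop, c / 2 ≤ l n * q n * a n := by
    filter_upwards [hqa.eventually_le_const (half_pos hc_pos)] with n hn
    have h1 : c / (q n * a n) < l n + 1 := Nat.lt_floor_add_one _
    rw [div_lt_iff₀ (hqa_pos n)] at h1
    linarith
  have hlε : ∀ n, l n * q n * (|α - p n / q n| * q n) ≤ c * ρ n := fun n => by
    rw [hρ_mul, ← mul_assoc]
    exact mul_le_mul_of_nonneg_right (hl_le n) (hρ_nonneg n)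
  have hρc : ∀ C : ℝ, Tendsto (fun n => C * (c * ρ n)) atTop (𝓝 0) := fun C => by
    simpa using (h29a.const_mul c).const_mul C
  -- The times `l n * q n` are rigidity times of the rotation.
  have hrigid : Tendsto (fun n => (((l n * q n : ℕ) * α : ℝ) : UnitAddCircle)) atTop (𝓝 0) := by
    have hreal : Tendsto (fun n => (l n * (α - p n / q n) * q n : ℝ)) atTop (𝓝 0) := by
      refine squeeze_zero_norm (fun n => ?_) (by simpa using hρc 1)
      refine le_trans ?_ (hlε n)
      rw [Real.norm_eq_abs, abs_mul, abs_mul, Nat.abs_cast, Nat.abs_cast, mul_assoc, mul_assoc]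
      have : (1 : ℝ) ≤ q n := by exact_mod_cast hq_pos n
      exact mul_le_mul_of_nonneg_left (le_mul_of_one_le_left (by positivity) this) (by positivity)
    have hcoe := ((AddCircle.continuous_mk' (1 : ℝ)).tendsto 0).comp hreal
    refine (hcoe.congr fun n => ?_)
    have hq' : (q n : ℝ) ≠ 0 := by exact_mod_cast (hq_pos n).ne'
    simp only [Function.comp]
    rw [← sub_eq_zero]
    change (((l n * (α - p n / q n) * q n : ℝ) : UnitAddCircle) - _) = 0
    rw [← AddCircle.coe_sub, AddCircle.coe_eq_zero_iff]
    refine ⟨-(l n * p n), ?_⟩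
    rw [zsmul_eq_mul]
    push_cast
    field_simp
    ring
  have hI := hcob.tendsto_integral_norm_prod_sub_one hrigid
  simp only [prod_twistedCocycle_iterate] at hI
  have hlow : ∀ᶠ n in atTop, Real.pi * d * c / 4 ≤ (∫ x, ‖((z ^ (l n * q n) *
      Circle.exp (2 * Real.pi * (A * birkhoffSum (circleRotation α) f (l n * q n * r) (r • x) +
        B * birkhoffSum (circleRotation α) f (l n * q n * s) (s • x + (h : UnitAddCircle)))) :
          Circle) : ℂ) - 1‖ ∂AddCircle.haarAddCircle) +
      2 * Real.pi * (W * K * (c * ρ n)) := by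
    filter_upwards [hl_ge, (hρc (2 * Real.pi * t)).eventually_le_const (half_pos one_pos)]
      with n hln htn
    obtain ⟨k, hk, hkd⟩ := hdt (p n) (q n) (l n) (hq_pos n) (hcopr n)
    have hK0 : 0 ≤ K := by simpa using (abs_nonneg _).trans (hK 0 1)
    have hE : Continuous fun x : UnitAddCircle =>
        A * birkhoffSum (circleRotation α) f (l n * q n * r) (r • x) +
          B * birkhoffSum (circleRotation α) f (l n * q n * s) (s • x + (h : UnitAddCircle)) := by
      have h1 := continuous_birkhoffSum_circleRotation hfc α (l n * q n * r)
      have h2 := continuous_birkhoffSum_circleRotation hfc α (l n * q n * s)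
      fun_prop
    have hmain := two_pi_mul_norm_fourierHat_le hE
      (continuous_twistedBlockSum (α := α) (r := r) (s := s) (h := h) (A := A) (B := B) (p := p n)
        (q := q n) (l := l n) hfc)
      (b := M * c) (η := W * K * (c * ρ n)) (fun x => ?_) hc1 (fun x => ?_) (z ^ (l n * q n)) hk
    · have hcoef : d * (c / 2) * (1 / 2) ≤
          ‖fourierHat (twistedBlockSum α f r s h A B (p n) (q n) (l n)) k‖ := by
        refine le_trans ?_ hkd
        have h1 : 2 * Real.pi * (t * (l n * q n * (|α - p n / q n| * q n))) ≤ 1 / 2 := by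
          refine le_trans ?_ htn
          rw [← mul_assoc]
          exact mul_le_mul_of_nonneg_left (hlε n) (by positivity)
        gcongr
        linarith
      have := mul_le_mul_of_nonneg_left hcoef (by positivity : 0 ≤ 2 * Real.pi)
      linarith
    · refine (abs_twistedBlockSum_le hfc hf0 (hq_pos n) (hcopr n) (h28 n).1 x).trans ?_
      calc 2 * W * (l n * q n * ∑' k : ℕ+, ‖fourierHat f (((k : ℕ) * q n : ℕ) : ℤ)‖)
          ≤ 2 * W * (l n * q n * (a n / c₀)) := by
            gcongr
            exact (h28 n).2.1
        _ = 2 * W / c₀ * (l n * q n * a n) := by ring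
        _ ≤ M * c := mul_le_mul (by rw [hM]; linarith) (hl_le n) (by positivity) hM_pos.le
    · refine (abs_birkhoffSum_sub_twistedBlockSum_le hK x).trans ?_
      exact mul_le_mul_of_nonneg_left (hlε n) (by positivity)
  have hlim := ge_of_tendsto (hI.add ((hρc (W * K)).const_mul (2 * Real.pi))) hlow
  rw [mul_zero, add_zero] at hlim
  have : 0 < Real.pi * d * c / 4 := by positivity
  linarith
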